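/- **Proposition 4.1.** Let $\Omega\subset\mathbb{C}$ be a Jordan domain, i.e. the bounded connected component of the complement of a Jordan curve, let $D=\{z\in\mathbb{C}:|z|<1\}$, and let $\Phi:D\to\Omega$ be a Riemann map, i.e. a holomorphic bijection of $D$ onto $\Omega$. Denote also by $\Phi$ its continuous extension to the closed disk $\overline{D}$. Then for all real $A,B$ with $A<B<A+2\pi$, $$\operatorname{length}\,\Phi(\{e^{it}:A\le t\le B\})\;\le\;\liminf_{r\to1^-}\,\operatorname{length}\,\Phi(\{re^{it}:A\le t\le B\}).$$ Here, for $0<r\le 1$, $\operatorname{length}\,\Phi(\{re^{it}:A\le t\le B\})\in[0,\infty]$ is the length of the curve $t\mapsto\Phi(re^{it})$, $A\le t\le B$, that is, the supremum of $\sum_{j=0}^{N-1}|\Phi(re^{it_{j+1}})-\Phi(re^{it_j})|$ over all $N\ge 1$ and all partitions $A=t_0<t_1<\dots<t_N=B$. Both sides may be $+\infty$. -/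

import Mathlib

open Set Filter Topology Metric

/-- A Jordan curve in the plane: the image of an injective continuous map from the unit circle. -/
def IsJordanCurve (γ : Set ℂ) : Prop :=
  ∃ f : Circle → ℂ, Continuous f ∧ Function.Injective f ∧ range f = γ

/-- A Jordan domain: the interior of a Jordan curve `γ`, that is, the bounded connected component
of the complement of `γ`. -/
def IsJordanDomain (Ω : Set ℂ) : Prop :=
  ∃ γ : Set ℂ, IsJordanCurve γ ∧
    (∃ z ∈ γᶜ, Ω = connectedComponentIn γᶜ z) ∧ Bornology.IsBounded Ω

/-- `Φ` is a Riemann map of `Ω`: a holomorphic bijection from the open unit disk onto `Ω`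
(the values of `Φ` outside the open unit disk play no role). -/
structure IsRiemannMap (Φ : ℂ → ℂ) (Ω : Set ℂ) : Prop where
  differentiableOn : DifferentiableOn ℂ Φ (ball 0 1)
  bijOn : BijOn Φ (ball 0 1) Ω

/-- `F` is the continuous extension of `Φ` from the open unit disk to the closed unit disk. -/
structure IsContinuousExtension (F Φ : ℂ → ℂ) : Prop where
  continuousOn : ContinuousOn F (closedBall 0 1)
  eqOn : EqOn F Φ (ball 0 1)

/-- The length in `[0, ∞]` of the curve `t ↦ F (r * e ^ (i t))`, `A ≤ t ≤ B`: the supremum, over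
all finite nondecreasing sequences in `[A, B]`, of the lengths of the inscribed polygons. -/
noncomputable def arcLength (F : ℂ → ℂ) (r A B : ℝ) : ENNReal :=
  eVariationOn (fun t : ℝ => F (r * Complex.exp (Complex.I * t))) (Icc A B)

/-! Length is lower semicontinuous under pointwise convergence: each inscribed polygonal sum is
continuous in its finitely many vertices, and length is their supremum. The curves on radius `r`
converge pointwise to the boundary curve because `F` is continuous up to the circle. -/

/-- A continuous extension of `Φ` to the closed unit disk gives the radial limits of `Φ`. -/
theorem IsContinuousExtension.tendsto_radial {F Φ : ℂ → ℂ} (hF : IsContinuousExtension F Φ)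
    {w : ℂ} (hw : ‖w‖ = 1) :
    Tendsto (fun r : ℝ => Φ (r * w)) (𝓝[<] (1 : ℝ)) (𝓝 (F w)) := by
  have hr : ∀ᶠ r : ℝ in 𝓝[<] (1 : ℝ), (r : ℂ) * w ∈ ball (0 : ℂ) 1 := by
    filter_upwards [Ioo_mem_nhdsLT (zero_lt_one' ℝ)] with r hr
    simpa [hw, abs_of_pos hr.1] using hr.2
  have hlim : Tendsto (fun r : ℝ => (r : ℂ) * w) (𝓝[<] (1 : ℝ)) (𝓝 w) := by
    have hcont : Continuous fun r : ℝ => (r : ℂ) * w := by fun_prop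
    simpa using (hcont.tendsto 1).mono_left nhdsWithin_le_nhds
  have hwmem : w ∈ closedBall (0 : ℂ) 1 := by simp [hw]
  refine ((hF.continuousOn w hwmem).tendsto.comp (tendsto_nhdsWithin_iff.2
    ⟨hlim, hr.mono fun r h => ball_subset_closedBall h⟩)).congr' ?_
  filter_upwards [hr] with r h using hF.eqOn h

theorem proposition4p1 (Ω : Set ℂ) (hΩ : IsJordanDomain Ω)
    (Φ : ℂ → ℂ) (hΦ : IsRiemannMap Φ Ω)
    (F : ℂ → ℂ) (hF : IsContinuousExtension F Φ)
    (A B : ℝ) (hAB : A < B) (hB : B < A + 2 * Real.pi) :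
    arcLength F 1 A B ≤ liminf (fun r : ℝ => arcLength Φ r A B) (𝓝[<] (1 : ℝ)) := by
  refine le_of_forall_lt fun v hv => ?_
  -- An eventual lower bound passes to the liminf only as `≤`; the gap between `v` and `u` restores
  -- strictness.
  obtain ⟨u, hvu, hu⟩ := exists_between hv
  refine hvu.trans_le (le_liminf_of_le (by isBoundedDefault) ?_)
  refine (eVariationOn.lowerSemicontinuous_aux (fun t _ => ?_) hu).mono fun r hr => hr.le
  have hw : ‖Complex.exp (Complex.I * t)‖ = 1 := by
    rw [mul_comm, Complex.norm_exp_ofReal_mul_I]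
  simpa using hF.tendsto_radial hw
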